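/- **Model.** A linear contract setting consists of finite sets of states $\mathcal Y$, actions $\mathcal A$ and outcomes $\mathbb O$, an outcome map $o:\mathcal A\times\mathcal Y\to\mathbb O$, a value function $v:\mathbb O\to[0,1]$, pairwise different costs $c:\mathcal A\to[0,1]$, the policy space $\mathcal P=[0,1]$, and a finite nonempty benchmark set $\mathcal P_0\subseteq\mathcal P$. The Agent's utility is $U(a,p,y)=p\,v(o(a,y))-c(a)$ and the Principal's is $V(a,p,y)=(1-p)\,v(o(a,y))$. For $\pi\in\Delta(\mathcal Y)$, $a^*(p,\pi)$ is an action that maximizes $\mathbb E_{y\sim\pi}[U(a,p,y)]$ and, among the maximizers, maximizes $\mathbb E_{y\sim\pi}[V(a,p,y)]$, remaining ties being broken by an arbitrary fixed rule. For a horizon $T$, a Principal mechanism $\sigma$ is a randomized procedure that in each round $t\le T$ outputs a forecast $\pi_t\in\Delta(\mathcal Y)$, a policy $p_t\in\mathcal P$ and a recommendation $r_t\in\mathcal A$, depending on $y_{1:t-1}$, its own past outputs and its internal randomness, but not on the Agent's actions. (This includes the mechanisms with $p_t=\psi(\pi_t)$ and $r_t=a^*(p_t,\pi_t)$ for a rule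 $\psi$.) The constant mechanism $p_0\in\mathcal P_0$ always plays $p_0$ and recommends $r_t^{p_0}=a^*(p_0,\pi_t)$, with the same forecasts $\pi_t$. An Agent learning algorithm $\mathcal L$ maps $(y_{1:t-1},a_{1:t-1},r_{1:t},p_{1:t})$ to a distribution over $\mathcal A$ from which $a_t$ is drawn. Its contextual swap regret is $$\mathrm{SwapReg}(y_{1:T},p_{1:T},r_{1:T})=\mathbb E_{a_{1:T}}\Big[\max_{h:\mathcal P\times\mathcal A\times\mathcal A\to\mathcal A}\frac1T\sum_{t=1}^T\big(U(h(p_t,r_t,a_t),p_t,y_t)-U(a_t,p_t,y_t)\big)\Big].$$ Mechanisms and algorithms may depend on the horizon $T$. We say that $\mathcal L$ has contextual swap regret $o(1)$ against $\sigma$ if there is $\varepsilon_T\to0$ such that for all $T$ and all $y_{1:T}\in\mathcal Y^T$, for almost every realization of $\sigma$ on $y_{1:T}$, $\mathrm{SwapReg}(y_{1:T},p_{1:T},r_{1:T})\le\varepsilon_T$ and $\mathrm{SwapReg}(y_{1:T},(p_0,\dots,p_0),r^{p_0}_{1:T})\le\varepsilon_T$ for all $p_0\in\mathcal P_0$. The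 Principal's policy regret is $$\mathrm{PR}(\sigma,\mathcal L,y_{1:T})=\mathbb E_{\sigma}\Big[\max_{p_0\in\mathcal P_0}\mathbb E_{a_{1:T},a^{p_0}_{1:T}}\Big[\frac1T\sum_{t=1}^T\big(V(a_t^{p_0},p_0,y_t)-V(a_t,p_t,y_t)\big)\Big]\Big],$$ where $a_{1:T}$ and $a^{p_0}_{1:T}$ are generated by $\mathcal L$ in response to $\sigma$ and to the constant mechanism $p_0$ respectively. **Proposition.** There is a linear contract setting with two states, two actions and two outcomes such that for every Principal mechanism $\sigma$ one of the following holds: 1. no learning algorithm $\mathcal L$ has contextual swap regret $o(1)$ against $\sigma$; or 2. there are a learning algorithm $\mathcal L^*$ with contextual swap regret $o(1)$ against $\sigma$, state sequences $\bar y_{1:T}\in\mathcal Y^T$ (one for each $T$) and a constant $c>0$ such that $\mathrm{PR}(\sigma,\mathcal L^*,\bar y_{1:T})\ge c$ for all sufficiently large $T$. -/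

import Mathlib

open MeasureTheory Filter Topology

noncomputable section

namespace PrincipalAgent

/-- The data of a linear contract problem with states `Y`, actions `A` and outcomes `O`.
Policies are the linear contracts `p ∈ [0,1]` (`unitInterval`); `benchmarks` is the finite set of
policies against which the Principal's policy regret is measured. -/
structure LinearContractSetting (Y A O : Type) where
  outcome : A → Y → O
  value : O → ℝ
  value_mem : ∀ o, value o ∈ Set.Icc (0 : ℝ) 1
  cost : A → ℝ
  cost_mem : ∀ a, cost a ∈ Set.Icc (0 : ℝ) 1
  cost_injective : Function.Injective cost
  benchmarks : Finset unitInterval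
  benchmarks_nonempty : benchmarks.Nonempty

section Utilities

variable {Y A O : Type}

/-- The Agent's utility `U(a,p,y) = p · v(o(a,y)) - c(a)`. -/
def LinearContractSetting.agentUtility (S : LinearContractSetting Y A O)
    (a : A) (p : unitInterval) (y : Y) : ℝ :=
  (p : ℝ) * S.value (S.outcome a y) - S.cost a

/-- The Principal's utility `V(a,p,y) = (1 - p) · v(o(a,y))`. -/
def LinearContractSetting.principalUtility (S : LinearContractSetting Y A O)
    (a : A) (p : unitInterval) (y : Y) : ℝ :=
  (1 - (p : ℝ)) * S.value (S.outcome a y)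

variable [Fintype Y]

/-- `U(a,p,π)`, the expected utility of the Agent when the state is drawn from `π`. -/
def LinearContractSetting.agentUtilityExp (S : LinearContractSetting Y A O)
    (a : A) (p : unitInterval) (π : stdSimplex ℝ Y) : ℝ :=
  ∑ y, (π : Y → ℝ) y * S.agentUtility a p y

/-- `V(a,p,π)`, the expected utility of the Principal when the state is drawn from `π`. -/
def LinearContractSetting.principalUtilityExp (S : LinearContractSetting Y A O)
    (a : A) (p : unitInterval) (π : stdSimplex ℝ Y) : ℝ :=
  ∑ y, (π : Y → ℝ) y * S.principalUtility a p y

/-- `a` maximizes the Agent's expected utility under the prior `π`. -/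
def LinearContractSetting.IsAgentOptimal (S : LinearContractSetting Y A O)
    (p : unitInterval) (π : stdSimplex ℝ Y) (a : A) : Prop :=
  ∀ b, S.agentUtilityExp b p π ≤ S.agentUtilityExp a p π

/-- `a` is an optimal action of the Agent under the prior `π` and, among all those, one that is
best for the Principal. -/
def LinearContractSetting.IsBestResponse (S : LinearContractSetting Y A O)
    (p : unitInterval) (π : stdSimplex ℝ Y) (a : A) : Prop :=
  S.IsAgentOptimal p π a ∧
    ∀ b, S.IsAgentOptimal p π b → S.principalUtilityExp b p π ≤ S.principalUtilityExp a p π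

/-- A best-response rule `a*(p,π)`: a (Borel measurable) selection among the best responses, with
the remaining ties broken arbitrarily. -/
structure BestResponseRule (S : LinearContractSetting Y A O) where
  act : unitInterval → stdSimplex ℝ Y → A
  isBestResponse : ∀ p π, S.IsBestResponse p π (act p π)
  measurable_act : ∀ p a, MeasurableSet {π | act p π = a}

/-- A best-response rule exists for all finite sets of states and actions. -/
theorem nonempty_bestResponseRule [Finite A] [Nonempty A] (S : LinearContractSetting Y A O) :
    Nonempty (BestResponseRule S) := by
  classical
  have hU : ∀ a p, Measurable fun π : stdSimplex ℝ Y => S.agentUtilityExp a p π := fun a p =>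
    Finset.measurable_sum _ fun y _ =>
      ((measurable_pi_apply y).comp measurable_subtype_coe).mul_const _
  have hV : ∀ a p, Measurable fun π : stdSimplex ℝ Y => S.principalUtilityExp a p π := fun a p =>
    Finset.measurable_sum _ fun y _ =>
      ((measurable_pi_apply y).comp measurable_subtype_coe).mul_const _
  have hAll : ∀ q : A → stdSimplex ℝ Y → Prop, (∀ b, MeasurableSet {π | q b π}) →
      MeasurableSet {π | ∀ b, q b π} := fun q hq => by
    rw [Set.ofPred_forall]
    exact MeasurableSet.iInter hq
  have hOpt : ∀ p a, MeasurableSet {π | S.IsAgentOptimal p π a} := fun p a =>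
    hAll _ fun b => measurableSet_le (hU b p) (hU a p)
  have hBest : ∀ p a, MeasurableSet {π | S.IsBestResponse p π a} := fun p a =>
    (hOpt p a).inter (hAll _ fun b =>
      MeasurableSet.imp (hOpt p b) (measurableSet_le (hV b p) (hV a p)))
  have hne : ∀ p π, {a | S.IsBestResponse p π a}.Nonempty := fun p π => by
    obtain ⟨a₀, ha₀⟩ := Finite.exists_max fun a => S.agentUtilityExp a p π
    obtain ⟨a, ha, hmax⟩ := Set.exists_max_image {a | S.IsAgentOptimal p π a}
      (fun a => S.principalUtilityExp a p π) (Set.toFinite _) ⟨a₀, ha₀⟩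
    exact ⟨a, ha, hmax⟩
  let pick : Set A → A := fun s => if h : s.Nonempty then h.choose else Classical.arbitrary A
  have hpick : ∀ s : Set A, s.Nonempty → pick s ∈ s := fun s h => by
    simp only [pick, dif_pos h]; exact h.choose_spec
  refine ⟨⟨fun p π => pick {a | S.IsBestResponse p π a}, fun p π => hpick _ (hne p π), ?_⟩⟩
  intro p a
  have hset : {π | pick {a | S.IsBestResponse p π a} = a} =
      ⋃ s ∈ {s : Set A | pick s = a}, ⋂ b, {π | S.IsBestResponse p π b ↔ b ∈ s} := by
    ext π
    simp only [Set.mem_ofPred_eq, Set.mem_iUnion, Set.mem_iInter, exists_prop]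
    constructor
    · intro h
      exact ⟨_, h, fun b => Iff.rfl⟩
    · rintro ⟨s, hs, h⟩
      rw [show {a | S.IsBestResponse p π a} = s from Set.ext h, hs]
  rw [hset]
  refine MeasurableSet.biUnion (Set.to_countable _) fun s _ => MeasurableSet.iInter fun b => ?_
  by_cases hb : b ∈ s
  · simpa [hb] using hBest p b
  · simp only [hb, iff_false]; exact (hBest p b).compl

end Utilities

section Histories

variable {α : Type} {T : ℕ}

/-- The entries of `x` strictly before round `t`. -/
def before (x : Fin T → α) (t : Fin T) : Fin (t : ℕ) → α :=
  fun s => x (Fin.castLE t.isLt.le s)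

/-- The entries of `x` up to and including round `t`. -/
def upTo (x : Fin T → α) (t : Fin T) : Fin ((t : ℕ) + 1) → α :=
  fun s => x (Fin.castLE t.isLt s)

end Histories

/-- A randomized mechanism of the Principal for `T` rounds. `Ω` carries its internal randomness.
In each round it issues a forecast, a policy and a recommendation, which depend on the earlier
states and on the internal randomness (hence possibly on the mechanism's own earlier outputs), but
never on the Agent's actions. Mechanisms given by a forecasting algorithm and a choice rule `ψ`
are those with `policy = ψ (forecast)` and `recommendation = a*(policy, forecast)`. -/
structure Mechanism (Y A : Type) [Fintype Y] (T : ℕ) where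
  Ω : Type
  [measurableSpace : MeasurableSpace Ω]
  μ : Measure Ω
  [isProbabilityMeasure : IsProbabilityMeasure μ]
  forecast : (t : Fin T) → (Fin (t : ℕ) → Y) → Ω → stdSimplex ℝ Y
  policy : (t : Fin T) → (Fin (t : ℕ) → Y) → Ω → unitInterval
  recommendation : (t : Fin T) → (Fin (t : ℕ) → Y) → Ω → A
  measurable_forecast : ∀ t h, Measurable (forecast t h)
  measurable_policy : ∀ t h, Measurable (policy t h)
  measurable_recommendation : ∀ t h a, MeasurableSet {ω | recommendation t h ω = a}

attribute [instance] Mechanism.measurableSpace Mechanism.isProbabilityMeasure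

/-- A learning algorithm of the Agent for `T` rounds: from the earlier states, his own earlier
actions, and the recommendations and policies up to and including the current round, it produces
a distribution over actions. -/
structure AgentAlgorithm (Y A : Type) (T : ℕ) where
  act : (t : Fin T) → (Fin (t : ℕ) → Y) → (Fin (t : ℕ) → A) →
    (Fin ((t : ℕ) + 1) → A) → (Fin ((t : ℕ) + 1) → unitInterval) → PMF A
  measurable_act : ∀ t y a r b, Measurable fun p => act t y a r p b

section Play

variable {Y A O : Type} [Fintype Y] {T : ℕ}

/-- The realized policies `p_{1:T}` on the state sequence `y`. -/
def Mechanism.policies (σ : Mechanism Y A T) (y : Fin T → Y) (ω : σ.Ω) : Fin T → unitInterval :=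
  fun t => σ.policy t (before y t) ω

/-- The realized recommendations `r_{1:T}` on the state sequence `y`. -/
def Mechanism.recommendations (σ : Mechanism Y A T) (y : Fin T → Y) (ω : σ.Ω) : Fin T → A :=
  fun t => σ.recommendation t (before y t) ω

/-- The recommendations `a*(p₀, π_t)` issued by the constant mechanism `p₀`, for the realized
forecasts `π_t`. -/
def Mechanism.constRecommendations {S : LinearContractSetting Y A O} (br : BestResponseRule S)
    (σ : Mechanism Y A T) (p₀ : unitInterval) (y : Fin T → Y) (ω : σ.Ω) : Fin T → A :=
  fun t => br.act p₀ (σ.forecast t (before y t) ω)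

/-- The probability that the Agent plays `a_{1:T}` when the states, policies and recommendations
are `y`, `p`, `r`. -/
def AgentAlgorithm.actionProb (L : AgentAlgorithm Y A T)
    (y : Fin T → Y) (p : Fin T → unitInterval) (r a : Fin T → A) : ℝ :=
  ∏ t, (L.act t (before y t) (before a t) (upTo r t) (upTo p t) (a t)).toReal

variable [Fintype A]

/-- The expectation of `f(a_{1:T})` over the Agent's random actions. -/
def AgentAlgorithm.expect (L : AgentAlgorithm Y A T)
    (y : Fin T → Y) (p : Fin T → unitInterval) (r : Fin T → A) (f : (Fin T → A) → ℝ) : ℝ :=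
  ∑ a, L.actionProb y p r a * f a

/-- The Agent's contextual swap regret. The supremum, over the modification rules
`h : P × A × A → A`, is a maximum: only finitely many values of `h` matter. -/
def swapRegret (S : LinearContractSetting Y A O) (L : AgentAlgorithm Y A T)
    (y : Fin T → Y) (p : Fin T → unitInterval) (r : Fin T → A) : ℝ :=
  L.expect y p r fun a =>
    ⨆ h : unitInterval → A → A → A, (1 / (T : ℝ)) *
      ∑ t, (S.agentUtility (h (p t) (r t) (a t)) (p t) (y t) - S.agentUtility (a t) (p t) (y t))

/-- On the state sequence `y`, the contextual swap regret is at most `ε`, both for (almost) every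
realization of the deployed mechanism and for the corresponding run of each constant mechanism. -/
def SwapRegretLE (S : LinearContractSetting Y A O) (br : BestResponseRule S)
    (σ : Mechanism Y A T) (L : AgentAlgorithm Y A T) (y : Fin T → Y) (ε : ℝ) : Prop :=
  ∀ᵐ ω ∂σ.μ, swapRegret S L y (σ.policies y ω) (σ.recommendations y ω) ≤ ε ∧
    ∀ p₀ ∈ S.benchmarks, swapRegret S L y (fun _ => p₀) (σ.constRecommendations br p₀ y ω) ≤ ε

/-- The Principal's expected average utility, over the Agent's random actions. -/
def principalPayoff (S : LinearContractSetting Y A O) (L : AgentAlgorithm Y A T)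
    (y : Fin T → Y) (p : Fin T → unitInterval) (r : Fin T → A) : ℝ :=
  L.expect y p r fun a => (1 / (T : ℝ)) * ∑ t, S.principalUtility (a t) (p t) (y t)

/-- The Principal's policy regret `PR(σ, L, y_{1:T})`: the expectation over the mechanism's
randomness of the maximal gain from having used a constant benchmark policy, to which the Agent
would have responded by the same algorithm. -/
def policyRegret (S : LinearContractSetting Y A O) (br : BestResponseRule S)
    (σ : Mechanism Y A T) (L : AgentAlgorithm Y A T) (y : Fin T → Y) : ℝ :=
  ∫ ω, S.benchmarks.sup' S.benchmarks_nonempty (fun p₀ =>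
    principalPayoff S L y (fun _ => p₀) (σ.constRecommendations br p₀ y ω)
      - principalPayoff S L y (σ.policies y ω) (σ.recommendations y ω)) ∂σ.μ

/-- The learning algorithm `L` (one for each horizon) has contextual swap regret `o(1)` against
`σ`, uniformly over all state sequences. -/
def VanishingSwapRegret (S : LinearContractSetting Y A O) (br : BestResponseRule S)
    (σ : (T : ℕ) → Mechanism Y A T) (L : (T : ℕ) → AgentAlgorithm Y A T) : Prop :=
  ∃ ε : ℕ → ℝ, Tendsto ε atTop (𝓝 0) ∧
    ∀ (T : ℕ) (y : Fin T → Y), SwapRegretLE S br (σ T) (L T) y (ε T)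

end Play

end PrincipalAgent

end

/-! Let the Agent know a state sequence `ybar` in advance and, under one benchmark policy `q`, exert
effort whenever `ybar` foretells a success, as long as the states follow `ybar`. This is optimal ex
post except in the round in which the states depart from `ybar`, so it adds at most `2 / T` to the
swap regret of the algorithm `L` it modifies. The Agent observes only the modified actions; he
therefore resamples the actions of `L` from their conditional law given these.

For uniformly random states and a policy `p < 1/2`, effort costs an uninformed Agent more than it
earns him: each unit of effort loses him `(1/2 - p) / 2` and earns the Principal `(1 - p) / 2`. So
the Principal's average payoff against `L`, net of the Agent's swap regret, is at most `1/4`, also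
under policies `p ≥ 1/2`, which leave her no more than half of the value. Against informed effort
the benchmark `q ≤ 3/8` earns her at least `5/16`. A mechanism profits from informed effort only in
the rounds where it plays `q` itself, and it cannot play both of the two benchmarks at once: some
`q` and `ybar` yield policy regret bounded away from zero.
-/

noncomputable section

namespace PrincipalAgent

section Histories

variable {α : Type} {T : ℕ} {x x' : Fin T → α} {s t : Fin T}

theorem before_eq_before_iff : before x t = before x' t ↔ ∀ s < t, x s = x' s :=
  ⟨fun h s hs => congrFun h ⟨s, hs⟩, fun h => funext fun s => h _ s.isLt⟩

theorem upTo_eq_upTo_iff : upTo x t = upTo x' t ↔ ∀ s ≤ t, x s = x' s :=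
  ⟨fun h s hs => congrFun h ⟨s, Nat.lt_succ_of_le hs⟩,
    fun h => funext fun s => h _ (Nat.le_of_lt_succ s.isLt)⟩

theorem before_eq_of_le (hst : s ≤ t) (h : before x t = before x' t) : before x s = before x' s :=
  before_eq_before_iff.2 fun u hu => before_eq_before_iff.1 h u (hu.trans_le hst)

theorem upTo_eq_of_le (hst : s ≤ t) (h : upTo x t = upTo x' t) : upTo x s = upTo x' s :=
  upTo_eq_upTo_iff.2 fun u hu => upTo_eq_upTo_iff.1 h u (hu.trans hst)

theorem before_update_of_le (hst : s ≤ t) (b : α) :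
    before (Function.update x t b) s = before x s :=
  before_eq_before_iff.2 fun _ hu => Function.update_of_ne (hu.trans_le hst).ne _ _

theorem before_extend (h : Fin (t : ℕ) → α) (d : Fin T → α) :
    before (Function.extend (Fin.castLE t.isLt.le) h d) t = h :=
  funext fun s => (Fin.castLE_injective _).extend_apply h d s

theorem upTo_extend (h : Fin ((t : ℕ) + 1) → α) (d : Fin T → α) :
    upTo (Function.extend (Fin.castLE t.isLt) h d) t = h :=
  funext fun s => (Fin.castLE_injective _).extend_apply h d s

/-- Two sequences agree until they first part, so they part at most once. -/
theorem sum_ite_first_departure_le [DecidableEq α] (x x' : Fin T → α) {c : ℝ} (hc : 0 ≤ c) :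
    ∑ t, (if before x t = before x' t ∧ x t ≠ x' t then c else 0) ≤ c := by
  have hle : ∀ s t, before x t = before x' t → x s ≠ x' s → t ≤ s := fun s t h hs =>
    not_lt.1 fun hlt => hs (before_eq_before_iff.1 h s hlt)
  have hcard : (Finset.univ.filter fun t => before x t = before x' t ∧ x t ≠ x' t).card ≤ 1 := by
    refine Finset.card_le_one.2 fun s hs t ht => ?_
    simp only [Finset.mem_filter, Finset.mem_univ, true_and] at hs ht
    exact le_antisymm (hle t s hs.1 ht.2) (hle s t ht.1 hs.2)
  rw [← Finset.sum_filter, Finset.sum_const, nsmul_eq_mul]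
  exact mul_le_of_le_one_left hc (by exact_mod_cast hcard)

end Histories

section ConditionalLaw

variable {α β Ω : Type*}

theorem tsum_apply_mk_eq_map_fst (ν : PMF (β × α)) (b : β) :
    ∑' a, ν (b, a) = ν.map Prod.fst b := by
  classical
  rw [PMF.map_apply, ENNReal.tsum_prod', tsum_eq_single b fun b' hb' => by simp [hb'.symm]]
  simp

theorem map_apply_of_injective {g : α → β} (hg : Function.Injective g) (μ : PMF α) (a : α) :
    μ.map g (g a) = μ a := by
  classical
  simp [PMF.map_apply, hg.eq_iff]

open Classical in
/-- The conditional law of the second component of `ν` given that the first one is `b`. When `b`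
has probability zero it is an arbitrary point mass. -/
def condSnd [Nonempty α] (ν : PMF (β × α)) (b : β) : PMF α :=
  if h : ∑' a, ν (b, a) = 0 then PMF.pure (Classical.arbitrary α)
  else PMF.normalize (fun a => ν (b, a)) h
    (tsum_apply_mk_eq_map_fst ν b ▸ PMF.apply_ne_top _ b)

theorem map_fst_mul_condSnd [Nonempty α] (ν : PMF (β × α)) (b : β) (a : α) :
    ν.map Prod.fst b * condSnd ν b a = ν (b, a) := by
  rw [← tsum_apply_mk_eq_map_fst, condSnd]
  split_ifs with h
  · rw [h, zero_mul, ENNReal.tsum_eq_zero.1 h a]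
  · rw [PMF.normalize_apply, mul_left_comm, ENNReal.mul_inv_cancel h, mul_one]
    exact tsum_apply_mk_eq_map_fst ν b ▸ PMF.apply_ne_top _ b

variable [MeasurableSpace Ω]

theorem measurable_condSnd_apply [Nonempty α] [Countable α] {ν : Ω → PMF (β × α)}
    (hν : ∀ x, Measurable fun ω => ν ω x) (b : β) (a : α) :
    Measurable fun ω => condSnd (ν ω) b a := by
  classical
  have hsum : Measurable fun ω => ∑' a, ν ω (b, a) := Measurable.tsum fun a => hν (b, a)
  have heq : ∀ ω, condSnd (ν ω) b a = if ∑' a, ν ω (b, a) = 0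
      then PMF.pure (Classical.arbitrary α) a else ν ω (b, a) * (∑' a, ν ω (b, a))⁻¹ := fun ω => by
    rw [condSnd]; split_ifs <;> rfl
  simp_rw [heq]
  exact Measurable.ite (hsum (measurableSet_singleton 0)) measurable_const
    ((hν (b, a)).mul hsum.inv)

theorem measurable_map_apply [Countable α] {μ : Ω → PMF α} (hμ : ∀ a, Measurable fun ω => μ ω a)
    {g : Ω → α → β} (hg : ∀ a b, MeasurableSet {ω | g ω a = b}) (b : β) :
    Measurable fun ω => (μ ω).map (g ω) b := by
  classical
  simp_rw [PMF.map_apply]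
  refine Measurable.tsum fun a => Measurable.ite ?_ (hμ a) measurable_const
  simpa only [eq_comm] using hg a b

theorem sum_toReal_map_mul [Fintype α] [Fintype β] (μ : PMF α) (g : α → β) (f : β → ℝ) :
    ∑ b, (μ.map g b).toReal * f b = ∑ a, (μ a).toReal * f (g a) := by
  classical
  have hmap : ∀ b, (μ.map g b).toReal = ∑ a, if b = g a then (μ a).toReal else 0 := fun b => by
    rw [PMF.map_apply, tsum_fintype,
      ENNReal.toReal_sum fun a _ => by split_ifs <;> simp [PMF.apply_ne_top]]
    exact Finset.sum_congr rfl fun a _ => by split_ifs <;> simp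
  simp_rw [hmap, Finset.sum_mul]
  rw [Finset.sum_comm]
  simp

theorem sum_toReal_eq_one [Fintype α] (μ : PMF α) : ∑ a, (μ a).toReal = 1 := by
  rw [← ENNReal.toReal_sum fun a _ => μ.apply_ne_top a, ← tsum_fintype (L := .unconditional α),
    μ.tsum_coe, ENNReal.toReal_one]

end ConditionalLaw

section SequentialLaw

variable {A : Type} {T : ℕ}

theorem prod_condSnd [Nonempty A] (μ : PMF (Fin T → A)) (a : Fin T → A) :
    ∏ t, condSnd (μ.map fun x => (before x t, x t)) (before a t) (a t) = μ a := by
  induction T with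
  | zero =>
    rw [Fin.prod_univ_zero, ← μ.tsum_coe,
      tsum_eq_single a fun b hb => absurd (Subsingleton.elim b a) hb]
  | succ T ih =>
    have hinj : Function.Injective fun x : Fin (T + 1) → A =>
        (before x (Fin.last T), x (Fin.last T)) := fun x x' h => by
      rw [← Fin.snoc_init_self x, ← Fin.snoc_init_self x']
      exact congrArg₂ (Fin.snoc (α := fun _ => A)) (congrArg Prod.fst h) (congrArg Prod.snd h)
    have hinit := ih (μ.map Fin.init) (Fin.init a)
    have hlast := map_fst_mul_condSnd (μ.map fun x => (before x (Fin.last T), x (Fin.last T)))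
      (before a (Fin.last T)) (a (Fin.last T))
    simp only [PMF.map_comp] at hinit hlast
    rw [Fin.prod_univ_castSucc]
    calc _ = μ.map Fin.init (Fin.init a) * _ := congrArg (· * _) hinit
      _ = _ := hlast
      _ = μ a := map_apply_of_injective hinj μ a

/-- The law of the sequence whose entry at `t` is drawn from `k t`, given the entries before. -/
def seqLaw : {T : ℕ} → ((t : Fin T) → (Fin (t : ℕ) → A) → PMF A) → PMF (Fin T → A)
  | 0, _ => PMF.pure Fin.elim0
  | T + 1, k => (seqLaw fun t => k t.castSucc).bind fun h =>
      (k (Fin.last T) h).map (Fin.snoc (α := fun _ => A) h)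

theorem seqLaw_apply (k : (t : Fin T) → (Fin (t : ℕ) → A) → PMF A) (a : Fin T → A) :
    seqLaw k a = ∏ t, k t (before a t) (a t) := by
  classical
  induction T with
  | zero => simp [seqLaw, Subsingleton.elim a Fin.elim0]
  | succ T ih =>
    have hsnoc : ∀ h b, a = Fin.snoc (α := fun _ => A) h b ↔ h = Fin.init a ∧ b = a (Fin.last T) :=
      fun h b => by rw [← Fin.snoc_inj (α := fun _ => A), Fin.snoc_init_self, eq_comm]
    rw [seqLaw, PMF.bind_apply, Fin.prod_univ_castSucc]
    simp only [PMF.map_apply, hsnoc, ih]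
    rw [tsum_eq_single (Fin.init a) (by simp +contextual),
      tsum_eq_single (a (Fin.last T)) (by simp +contextual)]
    simp only [and_self, if_true]
    rfl

theorem map_init_seqLaw (k : (t : Fin (T + 1)) → (Fin (t : ℕ) → A) → PMF A) :
    (seqLaw k).map Fin.init = seqLaw fun t => k t.castSucc := by
  have hsnoc : ∀ h : Fin T → A,
      Fin.init ∘ Fin.snoc (α := fun _ => A) h = Function.const A h := fun h =>
    funext fun b => Fin.init_snoc (α := fun _ => A) b h
  simp only [seqLaw, PMF.map_bind, PMF.map_comp, hsnoc, PMF.map_const, PMF.bind_pure]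

theorem map_upTo_seqLaw_congr {k k' : (t : Fin T) → (Fin (t : ℕ) → A) → PMF A} {t : Fin T}
    (h : ∀ s ≤ t, k s = k' s) : (seqLaw k).map (upTo · t) = (seqLaw k').map (upTo · t) := by
  induction T with
  | zero => exact t.elim0
  | succ T ih =>
    induction t using Fin.lastCases with
    | last => rw [funext fun s => h s (Fin.le_last s)]
    | cast t =>
      have hcomp : ∀ k : (t : Fin (T + 1)) → (Fin (t : ℕ) → A) → PMF A,
          (seqLaw k).map (upTo · t.castSucc) =
            (seqLaw fun s => k s.castSucc).map (upTo · t) := fun k => by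
        rw [← map_init_seqLaw, PMF.map_comp]; rfl
      rw [hcomp, hcomp]
      exact ih fun s hs => h _ (Fin.castSucc_le_castSucc_iff.2 hs)

end SequentialLaw

section AlgorithmLaw

variable {Y A : Type} {T : ℕ}

/-- The joint law of the Agent's actions when the states, policies and recommendations are `y`,
`p`, `r`. -/
def AgentAlgorithm.law (L : AgentAlgorithm Y A T) (y : Fin T → Y) (p : Fin T → unitInterval)
    (r : Fin T → A) : PMF (Fin T → A) :=
  seqLaw fun t h => L.act t (before y t) h (upTo r t) (upTo p t)

theorem AgentAlgorithm.toReal_law_apply (L : AgentAlgorithm Y A T) (y : Fin T → Y)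
    (p : Fin T → unitInterval) (r a : Fin T → A) :
    (L.law y p r a).toReal = L.actionProb y p r a := by
  rw [law, seqLaw_apply, ENNReal.toReal_prod]
  rfl

theorem AgentAlgorithm.measurable_law_apply (L : AgentAlgorithm Y A T) (y : Fin T → Y)
    (r a : Fin T → A) : Measurable fun p => L.law y p r a := by
  simp_rw [law, seqLaw_apply]
  exact Finset.measurable_prod _ fun t _ => (L.measurable_act t _ _ _ _).comp
    (measurable_pi_lambda _ fun _ => measurable_pi_apply _)

/-- A family of laws of action sequences, indexed by the states, policies and recommendations, is
non-anticipating if the actions up to round `t` do not depend on what is revealed after the Agent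
moves in round `t`. In particular they do not depend on the state of round `t`. -/
def NonAnticipating (Q : (Fin T → Y) → (Fin T → unitInterval) → (Fin T → A) → PMF (Fin T → A)) :
    Prop :=
  ∀ ⦃t y y' p p' r r'⦄, before y t = before y' t → upTo p t = upTo p' t → upTo r t = upTo r' t →
    (Q y p r).map (upTo · t) = (Q y' p' r').map (upTo · t)

theorem AgentAlgorithm.nonAnticipating_law (L : AgentAlgorithm Y A T) : NonAnticipating L.law :=
  fun _ _ _ _ _ _ _ hy hp hr => map_upTo_seqLaw_congr fun s hs => by
    rw [before_eq_of_le hs hy, upTo_eq_of_le hs hp, upTo_eq_of_le hs hr]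

variable [Nonempty Y] [Nonempty A]
  {Q : (Fin T → Y) → (Fin T → unitInterval) → (Fin T → A) → PMF (Fin T → A)}

/-- The algorithm that draws each action from its conditional law under `Q`, given the Agent's
earlier actions. What the Agent has not seen yet is filled in arbitrarily, which is harmless if `Q`
is non-anticipating. -/
def AgentAlgorithm.ofLaw [Countable A] (hQ : ∀ y r a, Measurable fun p => Q y p r a) :
    AgentAlgorithm Y A T where
  act t y a r p := condSnd ((Q
      (Function.extend (Fin.castLE t.isLt.le) y fun _ => Classical.arbitrary Y)
      (Function.extend (Fin.castLE t.isLt) p fun _ => 0)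
      (Function.extend (Fin.castLE t.isLt) r fun _ => Classical.arbitrary A)).map
    fun x => (before x t, x t)) a
  measurable_act t y a r b := by
    have hextend : Measurable fun p : Fin ((t : ℕ) + 1) → unitInterval =>
        Function.extend (Fin.castLE t.isLt) p fun _ => 0 := by
      refine measurable_pi_lambda _ fun s => ?_
      simp only [Function.extend_def]
      split_ifs with h
      · exact measurable_pi_apply _
      · exact measurable_const
    exact measurable_condSnd_apply (measurable_map_apply (g := fun _ x => (before x t, x t))
      (fun x => (hQ _ _ x).comp hextend) fun _ _ => .const _) a b

theorem AgentAlgorithm.law_ofLaw [Countable A] (hQ : ∀ y r a, Measurable fun p => Q y p r a)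
    (hna : NonAnticipating Q) : (ofLaw hQ).law = Q := by
  funext y p r
  have hact : ∀ t h, (ofLaw hQ).act t (before y t) h (upTo r t) (upTo p t) =
      condSnd ((Q y p r).map fun x => (before x t, x t)) h := fun t h => by
    have hcomp : ∀ μ : PMF (Fin T → A), μ.map (fun x => (before x t, x t)) =
        (μ.map (upTo · t)).map fun x => (Fin.init x, x (Fin.last t)) := fun μ => by
      rw [PMF.map_comp]; rfl
    simp only [ofLaw]
    rw [hcomp, hna (before_extend _ _) (upTo_extend _ _) (upTo_extend _ _), ← hcomp]
  ext a
  simp only [law, seqLaw_apply, hact, prod_condSnd]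

end AlgorithmLaw

section Relabelling

/-- A rule that replaces the action of each round by another one, as a function of the earlier
states and the current policy. -/
structure Relabelling (Y A : Type) (T : ℕ) where
  map : (t : Fin T) → (Fin (t : ℕ) → Y) → unitInterval → A → A
  measurableSet_map : ∀ t h a b, MeasurableSet {p | map t h p a = b}

variable {Y A : Type} {T : ℕ}

/-- The relabelled action sequence. -/
def Relabelling.apply (φ : Relabelling Y A T) (y : Fin T → Y) (p : Fin T → unitInterval)
    (a : Fin T → A) : Fin T → A :=
  fun t => φ.map t (before y t) (p t) (a t)

theorem Relabelling.measurableSet_apply (φ : Relabelling Y A T) (y : Fin T → Y) (a b : Fin T → A) :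
    MeasurableSet {p | φ.apply y p a = b} := by
  simp only [funext_iff, Set.ofPred_forall]
  exact MeasurableSet.iInter fun t =>
    (φ.measurableSet_map t (before y t) (a t) (b t)).preimage (measurable_pi_apply t)

theorem Relabelling.nonAnticipating (φ : Relabelling Y A T)
    {Q : (Fin T → Y) → (Fin T → unitInterval) → (Fin T → A) → PMF (Fin T → A)}
    (hQ : NonAnticipating Q) :
    NonAnticipating fun y p r => (Q y p r).map (φ.apply y p) := by
  intro t y y' p p' r r' hy hp hr
  have hcongr : ∀ a, upTo (φ.apply y p a) t = upTo (φ.apply y' p' a) t := fun a =>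
    upTo_eq_upTo_iff.2 fun s hs => by
      simp only [apply, before_eq_of_le hs hy, upTo_eq_upTo_iff.1 hp s hs]
  have hcomp : ∀ μ : PMF (Fin T → A), (μ.map (φ.apply y' p')).map (upTo · t) =
      (μ.map (upTo · t)).map fun x s => φ.map _ (before y' (Fin.castLE t.isLt s))
        (p' (Fin.castLE t.isLt s)) (x s) := fun μ => by
    simp only [PMF.map_comp]; rfl
  rw [hcomp, ← hQ hy hp hr, ← hcomp]
  simp only [PMF.map_comp, Function.comp_def, hcongr]

variable [Nonempty Y] [Nonempty A]

/-- The algorithm whose actions are distributed as the relabelled actions of `L`. The Agent sees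
only the relabelled actions, so this is not a mere composition: the actions of `L` are resampled
from their conditional law. -/
def AgentAlgorithm.relabel [Countable A] (L : AgentAlgorithm Y A T) (φ : Relabelling Y A T) :
    AgentAlgorithm Y A T :=
  ofLaw (Q := fun y p r => (L.law y p r).map (φ.apply y p)) fun y r =>
    measurable_map_apply (fun a => L.measurable_law_apply y r a) (φ.measurableSet_apply y)

theorem AgentAlgorithm.law_relabel [Countable A] (L : AgentAlgorithm Y A T)
    (φ : Relabelling Y A T) (y : Fin T → Y) (p : Fin T → unitInterval) (r : Fin T → A) :
    (L.relabel φ).law y p r = (L.law y p r).map (φ.apply y p) := by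
  rw [relabel, law_ofLaw _ (φ.nonAnticipating L.nonAnticipating_law)]

theorem AgentAlgorithm.expect_relabel [Fintype A] (L : AgentAlgorithm Y A T)
    (φ : Relabelling Y A T) (y : Fin T → Y) (p : Fin T → unitInterval) (r : Fin T → A)
    (f : (Fin T → A) → ℝ) :
    (L.relabel φ).expect y p r f = L.expect y p r fun a => f (φ.apply y p a) := by
  classical
  simp only [expect, ← toReal_law_apply, law_relabel, sum_toReal_map_mul]

end Relabelling

section Expectation

variable {Y A : Type} {T : ℕ} (L : AgentAlgorithm Y A T) (y : Fin T → Y)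
  (p : Fin T → unitInterval) (r : Fin T → A)

/-- The probability that the Agent plays `b` in round `t`. -/
def AgentAlgorithm.playProb (t : Fin T) (b : A) : ℝ :=
  ((L.law y p r).map (· t) b).toReal

theorem AgentAlgorithm.playProb_mem_Icc (t : Fin T) (b : A) :
    L.playProb y p r t b ∈ Set.Icc (0 : ℝ) 1 :=
  ⟨ENNReal.toReal_nonneg,
    ENNReal.toReal_one ▸ ENNReal.toReal_mono ENNReal.one_ne_top (PMF.coe_le_one _ b)⟩

variable {y p r} in
theorem AgentAlgorithm.playProb_congr {y' : Fin T → Y} {p' : Fin T → unitInterval}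
    {r' : Fin T → A} {t : Fin T} (hy : before y t = before y' t) (hp : upTo p t = upTo p' t)
    (hr : upTo r t = upTo r' t) : L.playProb y p r t = L.playProb y' p' r' t := by
  have hcomp : ∀ μ : PMF (Fin T → A),
      μ.map (· t) = (μ.map (upTo · t)).map (· (Fin.last t)) := fun μ => by
    rw [PMF.map_comp]; rfl
  funext b
  rw [playProb, hcomp, L.nonAnticipating_law hy hp hr, ← hcomp, playProb]

variable [Fintype A]

variable {y p r} in
theorem AgentAlgorithm.expect_mono {f g : (Fin T → A) → ℝ} (h : ∀ a, f a ≤ g a) :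
    L.expect y p r f ≤ L.expect y p r g :=
  Finset.sum_le_sum fun a _ => mul_le_mul_of_nonneg_left (h a)
    (Finset.prod_nonneg fun _ _ => ENNReal.toReal_nonneg)

theorem AgentAlgorithm.expect_const (c : ℝ) : L.expect y p r (fun _ => c) = c := by
  classical
  simp only [expect, ← Finset.sum_mul, ← toReal_law_apply, sum_toReal_eq_one, one_mul]

theorem AgentAlgorithm.expect_add_const (f : (Fin T → A) → ℝ) (c : ℝ) :
    L.expect y p r (fun a => f a + c) = L.expect y p r f + c := by
  conv_rhs => rw [← L.expect_const y p r c]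
  simp only [expect, mul_add, Finset.sum_add_distrib]

theorem AgentAlgorithm.expect_mul_sum_apply (c : ℝ) (f : Fin T → A → ℝ) :
    L.expect y p r (fun a => c * ∑ t, f t (a t)) = c * ∑ t, ∑ b, L.playProb y p r t b * f t b := by
  classical
  simp only [expect, ← toReal_law_apply, playProb, sum_toReal_map_mul]
  rw [Finset.sum_comm, Finset.mul_sum]
  refine Finset.sum_congr rfl fun a _ => ?_
  rw [← Finset.mul_sum, mul_left_comm]

end Expectation

section Regret

variable {Y A O : Type} {T : ℕ} (S : LinearContractSetting Y A O)

theorem LinearContractSetting.abs_agentUtility_le_one (a : A) (p : unitInterval) (y : Y) :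
    |S.agentUtility a p y| ≤ 1 := by
  obtain ⟨hv₀, hv₁⟩ := S.value_mem (S.outcome a y)
  obtain ⟨hc₀, hc₁⟩ := S.cost_mem a
  rw [agentUtility, abs_le]
  constructor <;> linarith [mul_nonneg p.2.1 hv₀, mul_le_one₀ p.2.2 hv₀ hv₁]

theorem LinearContractSetting.principalUtility_mem_Icc (a : A) (p : unitInterval) (y : Y) :
    S.principalUtility a p y ∈ Set.Icc (0 : ℝ) 1 := by
  obtain ⟨hv₀, hv₁⟩ := S.value_mem (S.outcome a y)
  have hp₀ := sub_nonneg.2 p.2.2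
  exact ⟨mul_nonneg hp₀ hv₀, mul_le_one₀ (sub_le_self 1 p.2.1) hv₀ hv₁⟩

/-- The Agent's gain from playing `h a` instead of `a`: the summand of the swap regret. -/
def LinearContractSetting.deviationGain (h : A → A) (a : A) (p : unitInterval) (y : Y) : ℝ :=
  S.agentUtility (h a) p y - S.agentUtility a p y

theorem LinearContractSetting.deviationGain_le_two (h : A → A) (a : A) (p : unitInterval) (y : Y) :
    S.deviationGain h a p y ≤ 2 := by
  have hnew := (abs_le.1 (S.abs_agentUtility_le_one (h a) p y)).2
  have hold := (abs_le.1 (S.abs_agentUtility_le_one a p y)).1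
  rw [deviationGain]
  linarith

theorem LinearContractSetting.bddAbove_range_deviationGain (y : Fin T → Y)
    (p : Fin T → unitInterval) (r a : Fin T → A) :
    BddAbove (Set.range fun h : unitInterval → A → A → A =>
      (1 / (T : ℝ)) * ∑ t, S.deviationGain (h (p t) (r t)) (a t) (p t) (y t)) := by
  refine ⟨(1 / (T : ℝ)) * ∑ _t : Fin T, 2, Set.forall_mem_range.2 fun h => ?_⟩
  gcongr with t
  exact S.deviationGain_le_two ..

variable [Fintype A] (L : AgentAlgorithm Y A T) (y : Fin T → Y) (p : Fin T → unitInterval)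
  (r : Fin T → A)

theorem sum_deviationGain_le_swapRegret (h : unitInterval → A → A → A) :
    (1 / (T : ℝ)) * ∑ t, ∑ b, L.playProb y p r t b *
      S.deviationGain (h (p t) (r t)) b (p t) (y t) ≤ swapRegret S L y p r := by
  rw [← L.expect_mul_sum_apply]
  exact L.expect_mono fun a => le_ciSup (S.bddAbove_range_deviationGain y p r a) h

variable [Nonempty Y] [Nonempty A]

variable {S y p} in
theorem swapRegret_relabel_le {φ : Relabelling Y A T} {e : Fin T → ℝ}
    (hφ : ∀ h t b, S.deviationGain h (φ.map t (before y t) (p t) b) (p t) (y t) ≤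
      S.deviationGain h b (p t) (y t) + e t) :
    swapRegret S (L.relabel φ) y p r ≤ swapRegret S L y p r + (1 / (T : ℝ)) * ∑ t, e t := by
  rw [swapRegret, L.expect_relabel, swapRegret, ← L.expect_add_const]
  refine L.expect_mono fun a => ciSup_le fun h => ?_
  calc (1 / (T : ℝ)) * ∑ t, S.deviationGain (h (p t) (r t)) (φ.apply y p a t) (p t) (y t)
      ≤ (1 / (T : ℝ)) * ∑ t, (S.deviationGain (h (p t) (r t)) (a t) (p t) (y t) + e t) := by
        gcongr with t
        exact hφ _ t (a t)
    _ = (1 / (T : ℝ)) * ∑ t, S.deviationGain (h (p t) (r t)) (a t) (p t) (y t) +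
          (1 / (T : ℝ)) * ∑ t, e t := by rw [Finset.sum_add_distrib, mul_add]
    _ ≤ _ := by
        gcongr
        exact le_ciSup (S.bddAbove_range_deviationGain y p r a) h

theorem principalPayoff_relabel (φ : Relabelling Y A T) :
    principalPayoff S (L.relabel φ) y p r = (1 / (T : ℝ)) * ∑ t, ∑ b, L.playProb y p r t b *
      S.principalUtility (φ.map t (before y t) (p t) b) (p t) (y t) := by
  rw [principalPayoff, L.expect_relabel, ← L.expect_mul_sum_apply]
  rfl

end Regret

section PolicyRegret

variable {Y A O Ω : Type} {T : ℕ} [MeasurableSpace Ω]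
  {p : Ω → Fin T → unitInterval} {r : Ω → Fin T → A}

theorem AgentAlgorithm.measurable_actionProb [Finite A] (L : AgentAlgorithm Y A T) (y : Fin T → Y)
    (a : Fin T → A) (hp : ∀ t, Measurable fun ω => p ω t)
    (hr : ∀ t b, MeasurableSet {ω | r ω t = b}) :
    Measurable fun ω => L.actionProb y (p ω) (r ω) a := by
  classical
  have := Fintype.ofFinite A
  have hr' : ∀ r', MeasurableSet {ω | r ω = r'} := fun r' => by
    simp only [funext_iff, Set.ofPred_forall]
    exact MeasurableSet.iInter fun t => hr t (r' t)
  have hsum : ∀ ω, L.actionProb y (p ω) (r ω) a =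
      ∑ r', if r ω = r' then (L.law y (p ω) r' a).toReal else 0 := fun ω => by
    rw [Finset.sum_ite_eq, if_pos (Finset.mem_univ _), L.toReal_law_apply]
  simp_rw [hsum]
  exact Finset.measurable_sum _ fun r' _ => Measurable.ite (hr' r')
    ((L.measurable_law_apply y r' a).comp (measurable_pi_lambda _ hp)).ennreal_toReal
    measurable_const

variable [Fintype A]

theorem measurable_principalPayoff (S : LinearContractSetting Y A O) (L : AgentAlgorithm Y A T)
    (y : Fin T → Y) (hp : ∀ t, Measurable fun ω => p ω t)
    (hr : ∀ t b, MeasurableSet {ω | r ω t = b}) :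
    Measurable fun ω => principalPayoff S L y (p ω) (r ω) :=
  Finset.measurable_sum _ fun a _ => (L.measurable_actionProb y a hp hr).mul
    (measurable_const.mul (Finset.measurable_sum _ fun t _ =>
      (measurable_const.sub (measurable_subtype_coe.comp (hp t))).mul_const _))

theorem principalPayoff_mem_Icc (S : LinearContractSetting Y A O) (L : AgentAlgorithm Y A T)
    (y : Fin T → Y) (p : Fin T → unitInterval) (r : Fin T → A) :
    principalPayoff S L y p r ∈ Set.Icc (0 : ℝ) 1 := by
  have hV := fun (a : Fin T → A) t => S.principalUtility_mem_Icc (a t) (p t) (y t)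
  constructor
  · refine (L.expect_const y p r 0).symm.le.trans (L.expect_mono fun a => ?_)
    exact mul_nonneg (by positivity) (Finset.sum_nonneg fun t _ => (hV a t).1)
  · refine (L.expect_mono fun a => ?_).trans (L.expect_const y p r 1).le
    calc (1 / (T : ℝ)) * ∑ t, S.principalUtility (a t) (p t) (y t)
        ≤ (1 / (T : ℝ)) * ∑ _t : Fin T, (1 : ℝ) := by gcongr with t; exact (hV a t).2
      _ ≤ 1 := by simpa using inv_mul_le_one

variable [Fintype Y]

/-- The gain of the constant mechanism `p₀` over `σ`, in one realization of `σ`. -/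
def benchmarkGain (S : LinearContractSetting Y A O) (br : BestResponseRule S)
    (σ : Mechanism Y A T) (L : AgentAlgorithm Y A T) (y : Fin T → Y) (p₀ : unitInterval)
    (ω : σ.Ω) : ℝ :=
  principalPayoff S L y (fun _ => p₀) (σ.constRecommendations br p₀ y ω)
    - principalPayoff S L y (σ.policies y ω) (σ.recommendations y ω)

variable (S : LinearContractSetting Y A O) (br : BestResponseRule S) (σ : Mechanism Y A T)
  (L : AgentAlgorithm Y A T) (y : Fin T → Y)

theorem measurable_benchmarkGain (p₀ : unitInterval) : Measurable (benchmarkGain S br σ L y p₀) :=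
  (measurable_principalPayoff S L y (fun _ => measurable_const) fun t b =>
      (br.measurable_act p₀ b).preimage (σ.measurable_forecast t (before y t))).sub
    (measurable_principalPayoff S L y (fun t => σ.measurable_policy t (before y t)) fun t b =>
      σ.measurable_recommendation t (before y t) b)

theorem integrable_benchmarkGain (p₀ : unitInterval) :
    Integrable (benchmarkGain S br σ L y p₀) σ.μ :=
  Integrable.of_bound (measurable_benchmarkGain S br σ L y p₀).aestronglyMeasurable 1 <|
    ae_of_all _ fun _ => Real.dist_le_of_mem_Icc_01 (principalPayoff_mem_Icc ..)
      (principalPayoff_mem_Icc ..)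

theorem integral_benchmarkGain_le_policyRegret {p₀ : unitInterval} (hp₀ : p₀ ∈ S.benchmarks) :
    ∫ ω, benchmarkGain S br σ L y p₀ ω ∂σ.μ ≤ policyRegret S br σ L y := by
  have hsup : Integrable (S.benchmarks.sup' S.benchmarks_nonempty (benchmarkGain S br σ L y)) σ.μ :=
    Finset.sup'_induction (p := fun f => Integrable f σ.μ) _ _ (fun _ hf _ hg => hf.sup hg)
      fun p _ => integrable_benchmarkGain S br σ L y p
  refine integral_mono (integrable_benchmarkGain S br σ L y p₀) (hsup.congr ?_) fun ω =>
    Finset.le_sup' (fun p => benchmarkGain S br σ L y p ω) hp₀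
  exact ae_of_all _ fun ω => Finset.sup'_apply ..

end PolicyRegret

section Averaging

/-- Resampling one coordinate of a uniformly random point leaves its law unchanged. -/
theorem sum_sum_eq_card_nsmul_sum_apply {ι α M : Type*} [Fintype ι] [DecidableEq ι] [Fintype α]
    [AddCommMonoid M] (i : ι) {g : (ι → α) → α → M} (hg : ∀ y b, g (Function.update y i b) = g y) :
    ∑ y, ∑ b, g y b = Fintype.card α • ∑ y, g y (y i) := by
  have hinv : Function.Involutive fun x : (ι → α) × α => (Function.update x.1 i x.2, x.1 i) :=
    fun x => by simp
  calc ∑ y, ∑ b, g y b = ∑ x : (ι → α) × α, g x.1 x.2 := (Fintype.sum_prod_type' g).symm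
    _ = ∑ x : (ι → α) × α, g x.1 (x.1 i) :=
        (Fintype.sum_equiv hinv.toPerm _ _ fun x => by simp [hg]).symm
    _ = ∑ _b : α, ∑ y, g y (y i) := Fintype.sum_prod_type_right' fun y _ => g y (y i)
    _ = _ := by rw [Finset.sum_const, Finset.card_univ]

end Averaging

section EffortSetting

/-- The setting of the theorem. Action `1` (effort) costs `1/4` and succeeds in state `1` only;
action `0` is free and never succeeds. The benchmarks are two different policies in `(1/4, 1/2)`:
effort is worthwhile to an Agent who knows that the state is `1`, but not to one who holds both
states equally likely. -/
def effortSetting : LinearContractSetting (Fin 2) (Fin 2) (Fin 2) where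
  outcome a y := if a = 1 ∧ y = 1 then 1 else 0
  value o := if o = 1 then 1 else 0
  value_mem o := by split_ifs <;> simp
  cost a := if a = 1 then 1 / 4 else 0
  cost_mem a := by split_ifs <;> norm_num
  cost_injective a b h := by
    fin_cases a <;> fin_cases b <;> simp_all
  benchmarks := {⟨1 / 3, by norm_num, by norm_num⟩, ⟨3 / 8, by norm_num, by norm_num⟩}
  benchmarks_nonempty := Finset.insert_nonempty _ _

theorem effortSetting_agentUtility (a : Fin 2) (p : unitInterval) (y : Fin 2) :
    effortSetting.agentUtility a p y =
      if a = 1 then (p : ℝ) * (if y = 1 then 1 else 0) - 1 / 4 else 0 := by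
  by_cases ha : a = 1 <;> by_cases hy : y = 1 <;>
    simp [LinearContractSetting.agentUtility, effortSetting, ha, hy]

theorem effortSetting_principalUtility (a : Fin 2) (p : unitInterval) (y : Fin 2) :
    effortSetting.principalUtility a p y = if a = 1 ∧ y = 1 then 1 - (p : ℝ) else 0 := by
  by_cases h : a = 1 ∧ y = 1 <;> simp [LinearContractSetting.principalUtility, effortSetting, h]

theorem mem_Icc_of_mem_benchmarks {q : unitInterval} (hq : q ∈ effortSetting.benchmarks) :
    (q : ℝ) ∈ Set.Icc (1 / 4 : ℝ) (3 / 8) := by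
  rcases Finset.mem_insert.1 hq with rfl | hq
  · norm_num
  · rw [Finset.mem_singleton.1 hq]
    norm_num

variable {T : ℕ} {q : unitInterval}

/-- As long as the states agree with `ybar`, exert effort whenever the policy is `q` and `ybar`
foretells the state `1`. -/
def informedEffort (q : unitInterval) (ybar : Fin T → Fin 2) : Relabelling (Fin 2) (Fin 2) T where
  map t h p a := if p = q ∧ ybar t = 1 ∧ h = before ybar t then 1 else a
  measurableSet_map _ _ _ b :=
    (Measurable.ite ((measurableSet_singleton q).inter (.const _)) measurable_const
      measurable_const) (measurableSet_singleton b)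

/-- Informed effort is optimal ex post, except in the round in which the states depart from
`ybar`. -/
theorem deviationGain_informedEffort_le (hq : 1 / 4 ≤ (q : ℝ)) (ybar y : Fin T → Fin 2)
    (p : unitInterval) (h : Fin 2 → Fin 2) (t : Fin T) (b : Fin 2) :
    effortSetting.deviationGain h ((informedEffort q ybar).map t (before y t) p b) p (y t) ≤
      effortSetting.deviationGain h b p (y t) +
        if before y t = before ybar t ∧ y t ≠ ybar t then 2 else 0 := by
  have hunchanged : ∀ x, x ≤ x + if before y t = before ybar t ∧ y t ≠ ybar t then (2 : ℝ) else 0 :=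
    fun x => le_add_of_nonneg_right (by split_ifs <;> norm_num)
  by_cases hinformed : p = q ∧ ybar t = 1 ∧ before y t = before ybar t
  swap
  · simpa only [informedEffort, if_neg hinformed] using hunchanged _
  simp only [informedEffort, if_pos hinformed]
  obtain rfl | rfl : b = 1 ∨ b = 0 := by omega
  · exact hunchanged _
  obtain ⟨rfl, hybar, hbefore⟩ := hinformed
  by_cases hy : y t = 1
  · have hnew : effortSetting.deviationGain h 1 p (y t) ≤ 0 := by
      simp only [LinearContractSetting.deviationGain, effortSetting_agentUtility, hy, if_true]
      split_ifs <;> linarith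
    have hold : 0 ≤ effortSetting.deviationGain h 0 p (y t) := by
      simp only [LinearContractSetting.deviationGain, effortSetting_agentUtility, hy, if_true,
        zero_ne_one, if_false]
      split_ifs <;> linarith
    exact (hnew.trans hold).trans (hunchanged _)
  · have hdeparted : before y t = before ybar t ∧ y t ≠ ybar t := ⟨hbefore, hybar ▸ hy⟩
    simp only [if_pos hdeparted, LinearContractSetting.deviationGain, effortSetting_agentUtility,
      hy, if_true, zero_ne_one, if_false]
    split_ifs <;> linarith

theorem swapRegret_relabel_informedEffort_le (hq : 1 / 4 ≤ (q : ℝ))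
    (L : AgentAlgorithm (Fin 2) (Fin 2) T) (ybar y : Fin T → Fin 2) (p : Fin T → unitInterval)
    (r : Fin T → Fin 2) :
    swapRegret effortSetting (L.relabel (informedEffort q ybar)) y p r ≤
      swapRegret effortSetting L y p r + 2 / T := by
  refine (swapRegret_relabel_le L r fun h t b =>
    deviationGain_informedEffort_le hq ybar y (p t) h t b).trans ?_
  rw [div_eq_mul_one_div 2 (T : ℝ), mul_comm 2]
  gcongr
  exact sum_ite_first_departure_le y ybar zero_le_two

theorem SwapRegretLE.relabel_informedEffort {br : BestResponseRule effortSetting}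
    {σ : Mechanism (Fin 2) (Fin 2) T} {L : AgentAlgorithm (Fin 2) (Fin 2) T} {y : Fin T → Fin 2}
    {ε : ℝ} (hL : SwapRegretLE effortSetting br σ L y ε) (hq : 1 / 4 ≤ (q : ℝ))
    (ybar : Fin T → Fin 2) :
    SwapRegretLE effortSetting br σ (L.relabel (informedEffort q ybar)) y (ε + 2 / T) :=
  hL.mono fun _ hω =>
    ⟨(swapRegret_relabel_informedEffort_le hq ..).trans (add_le_add_left hω.1 _), fun p₀ hp₀ =>
      (swapRegret_relabel_informedEffort_le hq ..).trans (add_le_add_left (hω.2 p₀ hp₀) _)⟩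

variable (q) in
theorem principalPayoff_relabel_informedEffort (L : AgentAlgorithm (Fin 2) (Fin 2) T)
    (y : Fin T → Fin 2) (p : Fin T → unitInterval) (r : Fin T → Fin 2) :
    principalPayoff effortSetting (L.relabel (informedEffort q y)) y p r =
      (1 / (T : ℝ)) * ∑ t, (if p t = q then 1 else L.playProb y p r t 1) *
        effortSetting.principalUtility 1 (p t) (y t) := by
  rw [principalPayoff_relabel]
  congr! 2 with t
  have hprob : L.playProb y p r t 0 + L.playProb y p r t 1 = 1 := by
    rw [← Fin.sum_univ_two (L.playProb y p r t)]
    exact sum_toReal_eq_one _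
  by_cases hpq : p t = q <;> by_cases hy : y t = 1 <;>
    simp [informedEffort, effortSetting_principalUtility, hpq, hy, ← add_mul, hprob]

theorem sum_giveUpEffort_le_swapRegret (L : AgentAlgorithm (Fin 2) (Fin 2) T) (y : Fin T → Fin 2)
    (p : Fin T → unitInterval) (r : Fin T → Fin 2) :
    (1 / (T : ℝ)) * ∑ t, (if (p t : ℝ) < 1 / 2 then
      -(L.playProb y p r t 1 * effortSetting.agentUtility 1 (p t) (y t)) else 0) ≤
        swapRegret effortSetting L y p r := by
  refine le_of_eq_of_le ?_ (sum_deviationGain_le_swapRegret effortSetting L y p r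
    fun p _ a => if (p : ℝ) < 1 / 2 then 0 else a)
  congr! 2 with t
  simp only [LinearContractSetting.deviationGain, Fin.sum_univ_two]
  split_ifs <;> simp [effortSetting_agentUtility, ← mul_neg]

/-- A lower bound for the contribution of one round, in which the state is `b`, the policy is `p`
and effort is exerted with probability `w`, to the sum of two gains: the Principal's from playing
`q`, when the Agent exerts informed effort under `q`, and the Agent's from giving up effort under
all policies below `1/2`. -/
def roundSurplus (q p : unitInterval) (w : ℝ) (b : Fin 2) : ℝ :=
  effortSetting.principalUtility 1 q b
    - (if p = q then 1 else w) * effortSetting.principalUtility 1 p b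
    + if (p : ℝ) < 1 / 2 then -(w * effortSetting.agentUtility 1 p b) else 0

theorem sum_roundSurplus (q p : unitInterval) (w : ℝ) :
    ∑ b, roundSurplus q p w b = (1 - (q : ℝ)) - (if p = q then 1 else w) * (1 - (p : ℝ)) +
      if (p : ℝ) < 1 / 2 then w * (1 / 2 - (p : ℝ)) else 0 := by
  simp only [Fin.sum_univ_two, roundSurplus, effortSetting_principalUtility,
    effortSetting_agentUtility, zero_ne_one, and_false, and_self, if_true, if_false]
  split_ifs <;> ring

theorem sum_roundSurplus_ge (hq : (q : ℝ) ≤ 3 / 8) (p : unitInterval) {w : ℝ}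
    (hw : w ∈ Set.Icc (0 : ℝ) 1) :
    (if p = q then 0 else 1 / 8) ≤ ∑ b, roundSurplus q p w b := by
  rw [sum_roundSurplus]
  by_cases hpq : p = q
  · have hgiveUp : 0 ≤ w * (1 / 2 - (q : ℝ)) := mul_nonneg hw.1 (by linarith)
    simp only [hpq, if_true, if_pos (show (q : ℝ) < 1 / 2 by linarith)]
    linarith
  simp only [if_neg hpq]
  by_cases hp : (p : ℝ) < 1 / 2
  · rw [if_pos hp]
    linarith [hw.2]
  · have hprincipal : w * (1 - (p : ℝ)) ≤ 1 - p :=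
      mul_le_of_le_one_left (sub_nonneg.2 p.2.2) hw.2
    rw [if_neg hp]
    linarith

/-- The policy `p` cannot be equal to both benchmarks. -/
theorem sum_benchmarks_sum_roundSurplus_ge (p : unitInterval) {w : ℝ}
    (hw : w ∈ Set.Icc (0 : ℝ) 1) :
    1 / 8 ≤ ∑ q ∈ effortSetting.benchmarks, ∑ b, roundSurplus q p w b := by
  refine le_trans ?_ (Finset.sum_le_sum fun q hq =>
    sum_roundSurplus_ge (mem_Icc_of_mem_benchmarks hq).2 p hw)
  rw [effortSetting, Finset.sum_pair (by norm_num)]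
  split_ifs with h₁ h₂
  · norm_num [h₁] at h₂
  all_goals norm_num

theorem sum_benchmarks_sum_states_roundSurplus_ge (t : Fin T) {P : (Fin T → Fin 2) → unitInterval}
    {w : (Fin T → Fin 2) → ℝ} (hP : ∀ y b, P (Function.update y t b) = P y)
    (hw : ∀ y b, w (Function.update y t b) = w y) (hwmem : ∀ y, w y ∈ Set.Icc (0 : ℝ) 1) :
    ∑ _y : Fin T → Fin 2, (1 / 16 : ℝ) ≤
      ∑ q ∈ effortSetting.benchmarks, ∑ y, roundSurplus q (P y) (w y) (y t) := by
  have hresample := sum_sum_eq_card_nsmul_sum_apply t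
    (g := fun y b => ∑ q ∈ effortSetting.benchmarks, roundSurplus q (P y) (w y) b)
    fun y b => by simp only [hP, hw]
  have hsurplus : ∑ _y : Fin T → Fin 2, (1 / 8 : ℝ) ≤
      ∑ y, ∑ b, ∑ q ∈ effortSetting.benchmarks, roundSurplus q (P y) (w y) b :=
    Finset.sum_le_sum fun y _ => by
      rw [Finset.sum_comm]
      exact sum_benchmarks_sum_roundSurplus_ge (P y) (hwmem y)
  rw [hresample, Fintype.card_fin, two_nsmul, Finset.sum_comm] at hsurplus
  simp only [Finset.sum_const, nsmul_eq_mul] at hsurplus ⊢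
  linarith

end EffortSetting

section LowerBound

variable {T : ℕ} (br : BestResponseRule effortSetting) (σ : Mechanism (Fin 2) (Fin 2) T)
  (L : AgentAlgorithm (Fin 2) (Fin 2) T)

theorem average_roundSurplus_le (q : unitInterval) (y : Fin T → Fin 2) (ω : σ.Ω) :
    (1 / (T : ℝ)) * ∑ t, roundSurplus q (σ.policies y ω t)
        (L.playProb y (σ.policies y ω) (σ.recommendations y ω) t 1) (y t) ≤
      benchmarkGain effortSetting br σ (L.relabel (informedEffort q y)) y q ω +
        swapRegret effortSetting L y (σ.policies y ω) (σ.recommendations y ω) := by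
  simp only [benchmarkGain, principalPayoff_relabel_informedEffort, if_true, one_mul, roundSurplus,
    Finset.sum_add_distrib, Finset.sum_sub_distrib, mul_add, mul_sub]
  gcongr
  exact sum_giveUpEffort_le_swapRegret ..

theorem sum_benchmarkGain_add_swapRegret_ge (hT : 0 < T) (ω : σ.Ω) :
    ∑ _y : Fin T → Fin 2, (1 / 16 : ℝ) ≤ ∑ q ∈ effortSetting.benchmarks, ∑ y,
      (benchmarkGain effortSetting br σ (L.relabel (informedEffort q y)) y q ω +
        swapRegret effortSetting L y (σ.policies y ω) (σ.recommendations y ω)) := by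
  have hpolicy : ∀ {s t : Fin T}, s ≤ t → ∀ y b,
      σ.policies (Function.update y t b) ω s = σ.policies y ω s := fun hst y b => by
    rw [Mechanism.policies, before_update_of_le hst, Mechanism.policies]
  have hrec : ∀ {s t : Fin T}, s ≤ t → ∀ y b,
      σ.recommendations (Function.update y t b) ω s = σ.recommendations y ω s := fun hst y b => by
    rw [Mechanism.recommendations, before_update_of_le hst, Mechanism.recommendations]
  have hprob : ∀ t y b,
      L.playProb (Function.update y t b) (σ.policies (Function.update y t b) ω)
        (σ.recommendations (Function.update y t b) ω) t =
      L.playProb y (σ.policies y ω) (σ.recommendations y ω) t := fun t y b =>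
    L.playProb_congr (before_update_of_le le_rfl b)
      (upTo_eq_upTo_iff.2 fun s hs => hpolicy hs y b)
      (upTo_eq_upTo_iff.2 fun s hs => hrec hs y b)
  have haverage : ∀ c : ℝ, c = (1 / (T : ℝ)) * ∑ _t : Fin T, c := fun c => by simp [hT.ne']
  calc ∑ _y : Fin T → Fin 2, (1 / 16 : ℝ)
      = (1 / (T : ℝ)) * ∑ _t : Fin T, ∑ _y : Fin T → Fin 2, (1 / 16 : ℝ) := haverage _
    _ ≤ (1 / (T : ℝ)) * ∑ t, ∑ q ∈ effortSetting.benchmarks, ∑ y,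
          roundSurplus q (σ.policies y ω t)
            (L.playProb y (σ.policies y ω) (σ.recommendations y ω) t 1) (y t) :=
        mul_le_mul_of_nonneg_left (Finset.sum_le_sum fun t _ =>
          sum_benchmarks_sum_states_roundSurplus_ge t (hpolicy le_rfl)
            (fun y b => congrFun (hprob t y b) 1) fun y => L.playProb_mem_Icc ..) (by positivity)
    _ = ∑ q ∈ effortSetting.benchmarks, ∑ y, (1 / (T : ℝ)) * ∑ t,
          roundSurplus q (σ.policies y ω t)
            (L.playProb y (σ.policies y ω) (σ.recommendations y ω) t 1) (y t) := by
        simp only [← Finset.mul_sum]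
        rw [Finset.sum_comm]
        congr! 2
        exact Finset.sum_comm
    _ ≤ _ := Finset.sum_le_sum fun q _ => Finset.sum_le_sum fun y _ =>
        average_roundSurplus_le br σ L q y ω

variable {br σ L} in
theorem exists_policyRegret_relabel_informedEffort_ge {ε : ℝ} (hT : 0 < T)
    (hL : ∀ y, SwapRegretLE effortSetting br σ L y ε) :
    ∃ q ∈ effortSetting.benchmarks, ∃ ybar : Fin T → Fin 2, 1 / 32 - ε ≤
      policyRegret effortSetting br σ (L.relabel (informedEffort q ybar)) ybar := by
  let gain (x : unitInterval × (Fin T → Fin 2)) : σ.Ω → ℝ :=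
    benchmarkGain effortSetting br σ (L.relabel (informedEffort x.1 x.2)) x.2 x.1
  have hint : ∀ x, Integrable (gain x) σ.μ := fun x => integrable_benchmarkGain ..
  have hcard : effortSetting.benchmarks.card = 2 := Finset.card_pair (by norm_num)
  have hgain : ∀ᵐ ω ∂σ.μ, ∑ _x ∈ effortSetting.benchmarks ×ˢ (Finset.univ : Finset (Fin T → Fin 2)),
      (1 / 32 - ε) ≤ ∑ x ∈ effortSetting.benchmarks ×ˢ Finset.univ, gain x ω := by
    filter_upwards [ae_all_iff.2 hL] with ω hω
    have hsum := sum_benchmarkGain_add_swapRegret_ge br σ L hT ω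
    have hregret : ∑ q ∈ effortSetting.benchmarks, ∑ y,
        swapRegret effortSetting L y (σ.policies y ω) (σ.recommendations y ω) ≤
          ∑ _q ∈ effortSetting.benchmarks, ∑ _y : Fin T → Fin 2, ε :=
      Finset.sum_le_sum fun _ _ => Finset.sum_le_sum fun y _ => (hω y).1
    simp only [Finset.sum_add_distrib] at hsum
    rw [Finset.sum_product, Finset.sum_product]
    simp only [Finset.sum_const, hcard, nsmul_eq_mul] at hsum hregret ⊢
    push_cast at hsum hregret ⊢
    linarith
  obtain ⟨⟨q, ybar⟩, hmem, hle⟩ : ∃ x ∈ effortSetting.benchmarks ×ˢ Finset.univ,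
      1 / 32 - ε ≤ ∫ ω, gain x ω ∂σ.μ := by
    refine Finset.exists_le_of_sum_le
      (effortSetting.benchmarks_nonempty.product Finset.univ_nonempty) ?_
    rw [← integral_finsetSum _ fun x _ => hint x]
    simpa using integral_mono_ae (integrable_const _) (integrable_finsetSum _ fun x _ => hint x)
      hgain
  have hq := (Finset.mem_product.1 hmem).1
  exact ⟨q, hq, ybar, hle.trans (integral_benchmarkGain_le_policyRegret _ br σ _ ybar hq)⟩

end LowerBound

end PrincipalAgent

end

theorem proposition1 :
    ∃ S : PrincipalAgent.LinearContractSetting (Fin 2) (Fin 2) (Fin 2),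
      ∀ (br : PrincipalAgent.BestResponseRule S)
        (σ : (T : ℕ) → PrincipalAgent.Mechanism (Fin 2) (Fin 2) T),
        (¬ ∃ L : (T : ℕ) → PrincipalAgent.AgentAlgorithm (Fin 2) (Fin 2) T,
            PrincipalAgent.VanishingSwapRegret S br σ L) ∨
        (∃ L : (T : ℕ) → PrincipalAgent.AgentAlgorithm (Fin 2) (Fin 2) T,
            PrincipalAgent.VanishingSwapRegret S br σ L ∧
            ∃ ybar : (T : ℕ) → Fin T → Fin 2, ∃ c : ℝ, 0 < c ∧
              ∀ᶠ T in Filter.atTop,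
                c ≤ PrincipalAgent.policyRegret S br (σ T) (L T) (ybar T)) := by
  refine ⟨PrincipalAgent.effortSetting, fun br σ => ?_⟩
  rw [or_iff_not_imp_left, not_not]
  rintro ⟨L, ε, hε, hL⟩
  have hinformed : ∀ T, ∃ q ∈ PrincipalAgent.effortSetting.benchmarks, ∃ ybar, 0 < T →
      1 / 32 - ε T ≤ PrincipalAgent.policyRegret _ br (σ T)
        ((L T).relabel (PrincipalAgent.informedEffort q ybar)) ybar := fun T => by
    rcases T.eq_zero_or_pos with rfl | hT
    · obtain ⟨q, hq⟩ := PrincipalAgent.effortSetting.benchmarks_nonempty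
      exact ⟨q, hq, Fin.elim0, fun h => absurd h (lt_irrefl 0)⟩
    · obtain ⟨q, hq, ybar, hle⟩ :=
        PrincipalAgent.exists_policyRegret_relabel_informedEffort_ge hT (hL T)
      exact ⟨q, hq, ybar, fun _ => hle⟩
  choose q hq ybar hregret using hinformed
  refine ⟨fun T => (L T).relabel (PrincipalAgent.informedEffort (q T) (ybar T)),
    ⟨fun T => ε T + 2 / T, ?_, fun T y => (hL T y).relabel_informedEffort
      (PrincipalAgent.mem_Icc_of_mem_benchmarks (hq T)).1 (ybar T)⟩,
    ybar, 1 / 64, by norm_num, ?_⟩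
  · simpa using hε.add (tendsto_const_div_atTop_nhds_zero_nat 2)
  · filter_upwards [hε.eventually_lt_const (show (0 : ℝ) < 1 / 64 by norm_num),
      eventually_gt_atTop 0] with T hT hpos
    linarith [hregret T hpos]
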